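/- **Setting.** Fix an integer $L\ge 2$ and reals $0<\lambda<1$, $\sigma^2>0$, $P_p>0$, $P_{\max}>0$, $\theta_p>0$, $\theta_s>0$; put $\gamma_p=P_p/\sigma^2$ and $\gamma_{\max}=P_{\max}/\sigma^2$. A primary user (PU) link with one antenna at each end coexists with a secondary user (SU) link with $L$ transmit antennas and one receive antenna. The PU channel $h_p\sim\mathcal{CN}(0,1)$, the SU channel $\mathbf h_s\in\mathbb C^L$ with i.i.d. $\mathcal{CN}(0,1)$ entries, and the channel $\mathbf h_x\in\mathbb C^L$ from the SU transmitter to the PU receiver with i.i.d. $\mathcal{CN}(0,\lambda)$ entries are independent. Write $g_p=|h_p|^2$, $g_s=\|\mathbf h_s\|^2$, $\mathbf s_s=\mathbf h_s/\|\mathbf h_s\|$, $g_x=\|\mathbf h_x\|^2/\lambda$, $\mathbf s_x=\mathbf h_x/\|\mathbf h_x\|$. *Channel-direction feedback with $B$ bits.* The PU receiver feeds back a unit vector $\hat{\mathbf s}_x=Q(\mathbf s_x,U)$, where $Q$ is a measurable quantizer and $U$ is a random element (a randomization of the quantizer, possibly trivial) independent of $(h_p,\mathbf h_s,\mathbf h_x)$.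 The quantization error $\epsilon=1-|\hat{\mathbf s}_x^\dagger\mathbf s_x|^2$ is assumed to satisfy $\Pr(\epsilon\le\tau)=2^B\tau^{L-1}$ for $0\le\tau\le 2^{-B/(L-1)}$. *Perfect interference-power-control feedback, without feedforward.* Let $\omega=\sigma^2(\gamma_pg_p/\theta_p-1)$, and let $\eta=\omega/(\lambda g_x\epsilon)$ if $\omega\ge 0$ and $\eta=P_{\max}$ otherwise. The allowed SU power is $\hat\eta=\eta$ if $\omega\ge0$ and $\eta<P_{\max}$, and $\hat\eta=P_{\max}$ otherwise. *Orthogonal cognitive beamforming.* Almost surely the SU beamformer $\mathbf f\in\mathbb C^L$ maximizes $|\mathbf f^\dagger\mathbf s_s|^2$ subject to $\mathbf f^\dagger\hat{\mathbf s}_x=0$ and $\|\mathbf f\|^2\le\hat\eta$. The SU outage probability is $P_{\rm out}=\Pr(\mathsf{SNR}_s\le\theta_s)$ with $\mathsf{SNR}_s=\frac{g_s}{\sigma^2}|\mathbf f^\dagger\mathbf s_s|^2$. **Theorem.** With $\Gamma(a,x)=\int_x^\infty t^{a-1}e^{-t}\,dt$ $(x>0)$ and $$\varphi=e^{-\theta_p/\gamma_p}\,\frac{(L-1)\,\lambda\,\theta_p\,\theta_s\,\Gamma\!\left(L-2,\frac{\theta_s}{\gamma_{\max}}\right)}{\gamma_p\,\Gamma(L-1)},$$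 one has $$P_{\rm out}=1-\frac{\Gamma\!\left(L-1,\frac{\theta_s}{\gamma_{\max}}\right)}{\Gamma(L-1)}+\varphi\,2^{-\frac{B}{L-1}}+O\!\left(2^{-\frac{2B}{L-1}}\right),$$ where the constant in $O(\cdot)$ depends only on $L,\lambda,\sigma^2,P_p,P_{\max},\theta_p,\theta_s$, and the bound holds for every integer $B\ge 0$. -/

import Mathlib

open MeasureTheory ProbabilityTheory

universe u v

noncomputable section

/-- The circularly symmetric complex Gaussian law `CN(0, s)`: real and imaginary parts are
independent real Gaussians with mean `0` and variance `s / 2`. -/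
def complexGaussian (s : ℝ) : Measure ℂ :=
  ((gaussianReal 0 (s / 2).toNNReal).prod (gaussianReal 0 (s / 2).toNNReal)).map
    (fun z : ℝ × ℝ => (⟨z.1, z.2⟩ : ℂ))

/-- The law on `ℂ^L` (Euclidean norm) of a vector with i.i.d. `CN(0, s)` entries. -/
def complexGaussianVector (L : ℕ) (s : ℝ) : Measure (EuclideanSpace ℂ (Fin L)) :=
  (Measure.pi (fun _ : Fin L => complexGaussian s)).map (fun x => WithLp.toLp 2 x)

/-- The upper incomplete gamma function `Γ(a, x) = ∫_x^∞ t^(a-1) e^(-t) dt`, for `x > 0`. -/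
def upperGamma (a x : ℝ) : ℝ := ∫ t in Set.Ioi x, t ^ (a - 1) * Real.exp (-t)

/-- The shape (direction) `h / ‖h‖` of a channel vector. -/
def channelShape {L : ℕ} (h : EuclideanSpace ℂ (Fin L)) : EuclideanSpace ℂ (Fin L) :=
  ((‖h‖⁻¹ : ℝ) : ℂ) • h

/-- The parameters of the cognitive radio network. -/
structure CRParams where
  /-- number of antennas of the secondary transmitter -/
  L : ℕ
  /-- variance of the entries of the channel from the secondary transmitter
  to the primary receiver -/
  lam : ℝ
  /-- noise variance `σ²` -/
  noise : ℝ
  /-- transmission power of the primary transmitter -/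
  Pp : ℝ
  /-- maximum transmission power of the secondary transmitter -/
  Pmax : ℝ
  /-- SINR threshold of the primary link -/
  thetaP : ℝ
  /-- SNR threshold of the secondary link -/
  thetaS : ℝ
  two_le_L : 2 ≤ L
  lam_pos : 0 < lam
  lam_lt_one : lam < 1
  noise_pos : 0 < noise
  Pp_pos : 0 < Pp
  Pmax_pos : 0 < Pmax
  thetaP_pos : 0 < thetaP
  thetaS_pos : 0 < thetaS

namespace CRParams

/-- Primary transmit SNR. -/
def gammaP (p : CRParams) : ℝ := p.Pp / p.noise

/-- Maximum secondary transmit SNR. -/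
def gammaMax (p : CRParams) : ℝ := p.Pmax / p.noise

/-- The coefficient `φ` of the first-order term. -/
def phi (p : CRParams) : ℝ :=
  Real.exp (-(p.thetaP / p.gammaP)) *
    ((((p.L : ℝ) - 1) * p.lam * p.thetaP * p.thetaS *
        upperGamma ((p.L : ℝ) - 2) (p.thetaS / p.gammaMax)) /
      (p.gammaP * Real.Gamma ((p.L : ℝ) - 1)))

/-- The margin `σ² (γ_p g / θ_p - 1)`: the largest interference power that the primary receiver
tolerates when the primary channel power is `g`; it is negative when that receiver is in outage
without any interference. -/
def margin (p : CRParams) (g : ℝ) : ℝ := p.noise * (p.gammaP * g / p.thetaP - 1)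

/-- The unquantized interference-power-control signal without feedforward, for primary channel
power `g`, gain `gx` of the channel from the secondary transmitter to the primary receiver, and
quantization error `e`. -/
def ipc (p : CRParams) (g gx e : ℝ) : ℝ :=
  if 0 ≤ p.margin g then p.margin g / (p.lam * gx * e) else p.Pmax

/-- The transmission power allowed by perfect feedback of the interference-power-control signal:
the signal itself if it is relevant and smaller than `Pmax`, and `Pmax` otherwise. -/
def powerLimit (p : CRParams) (g gx e : ℝ) : ℝ :=
  if 0 ≤ p.margin g ∧ p.ipc g gx e < p.Pmax then p.ipc g gx e else p.Pmax

end CRParams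

/-- The feasible set of orthogonal cognitive beamforming: vectors orthogonal to the fed back
direction `shat` whose power `‖f‖²` is at most `P`. -/
def ocbFeasible {L : ℕ} (shat : EuclideanSpace ℂ (Fin L)) (P : ℝ) :
    Set (EuclideanSpace ℂ (Fin L)) :=
  {f | inner ℂ f shat = 0 ∧ ‖f‖ ^ 2 ≤ P}

/-- `f` is an orthogonal cognitive beamformer: it maximizes `|f† s|²` over the feasible set, where
`s` is the shape of the secondary channel. -/
def IsOCB {L : ℕ} (shat s : EuclideanSpace ℂ (Fin L)) (P : ℝ)
    (f : EuclideanSpace ℂ (Fin L)) : Prop :=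
  f ∈ ocbFeasible shat P ∧ IsMaxOn (fun w => ‖inner ℂ w s‖ ^ 2) (ocbFeasible shat P) f

/-- The channels, the channel-direction feedback and the beamformer, as random variables on a
probability space `(Ω, μ)`. The quantizer sees only the direction of the channel `hx`, and a
source of randomness `U` with values in `V` (for instance a random codebook) that is independent of
all the channels; a deterministic quantizer is the case where `V` is a point. -/
structure OCBLink (p : CRParams) {Ω : Type u} [MeasurableSpace Ω] (μ : Measure Ω)
    (V : Type v) [MeasurableSpace V] where
  /-- channel from the primary transmitter to the primary receiver -/
  hp : Ω → ℂ
  /-- channel from the secondary transmitter to the secondary receiver -/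
  hs : Ω → EuclideanSpace ℂ (Fin p.L)
  /-- channel from the secondary transmitter to the primary receiver -/
  hx : Ω → EuclideanSpace ℂ (Fin p.L)
  /-- randomness of the quantizer -/
  U : Ω → V
  /-- the direction quantizer -/
  Q : EuclideanSpace ℂ (Fin p.L) → V → EuclideanSpace ℂ (Fin p.L)
  /-- the beamformer -/
  f : Ω → EuclideanSpace ℂ (Fin p.L)
  law_hp : HasLaw hp (complexGaussian 1) μ
  law_hs : HasLaw hs (complexGaussianVector p.L 1) μ
  law_hx : HasLaw hx (complexGaussianVector p.L p.lam) μ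
  measurable_U : Measurable U
  measurable_Q : Measurable (Function.uncurry Q)
  /-- Together with the next two fields: `hp`, `hs`, `hx`, `U` are mutually independent. -/
  indep_hp : IndepFun hp (fun ω => (hs ω, hx ω, U ω)) μ
  indep_hs : IndepFun hs (fun ω => (hx ω, U ω)) μ
  indep_hx : IndepFun hx U μ
  /-- The fed back direction is a unit vector. -/
  norm_Q : ∀ᵐ ω ∂μ, ‖Q (channelShape (hx ω)) (U ω)‖ = 1
  /-- The beamformer is the orthogonal cognitive beamformer under perfect
  interference-power-control feedback. -/
  isOCB : ∀ᵐ ω ∂μ,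
    IsOCB (Q (channelShape (hx ω)) (U ω)) (channelShape (hs ω))
      (p.powerLimit (‖hp ω‖ ^ 2) (‖hx ω‖ ^ 2 / p.lam)
        (1 - ‖inner ℂ (Q (channelShape (hx ω)) (U ω)) (channelShape (hx ω))‖ ^ 2))
      (f ω)

namespace OCBLink

variable {p : CRParams} {Ω : Type u} [MeasurableSpace Ω] {μ : Measure Ω}
  {V : Type v} [MeasurableSpace V]

/-- The quantization error `1 - |ŝ† s|²` of the fed back channel direction. -/
def quantError (N : OCBLink p μ V) (ω : Ω) : ℝ :=
  1 - ‖inner ℂ (N.Q (channelShape (N.hx ω)) (N.U ω)) (channelShape (N.hx ω))‖ ^ 2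

/-- The `B`-bit quantization model: on `[0, 2^(-B/(L-1))]` the distribution function of the
quantization error is `2^B τ^(L-1)`. (It reaches `1` at the right end point.) -/
def IsBBitFeedback (N : OCBLink p μ V) (B : ℕ) : Prop :=
  ∀ τ : ℝ, 0 ≤ τ → τ ≤ (2 : ℝ) ^ (-((B : ℝ) / ((p.L : ℝ) - 1))) →
    μ.real {ω | N.quantError ω ≤ τ} = 2 ^ B * τ ^ (p.L - 1)

/-- The receive SNR `(g_s / σ²) |f† s_s|²` at the secondary receiver. -/
def snrS (N : OCBLink p μ V) (ω : Ω) : ℝ :=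
  ‖N.hs ω‖ ^ 2 / p.noise * ‖inner ℂ (N.f ω) (channelShape (N.hs ω))‖ ^ 2

/-- The outage probability of the secondary link. -/
def outageProb (N : OCBLink p μ V) : ℝ := μ.real {ω | N.snrS ω ≤ p.thetaS}

end OCBLink

end

/-!
Let `a = θ_s / γ_max`, `b = θ_p / γ_p`, let `Y = ‖h_s‖² - |ŝ_x† h_s|²` be the power of the secondary
channel orthogonal to the feedback and `Z = θ_s λ g_x ε`. The optimal beamformer collects the
fraction `P̂ Y / ‖h_s‖²` of the allowed power `P̂`, so up to a null set the link is in outage iff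
`Y ≤ a` or `b ≤ g_p ≤ b (1 + Z / Y)`: the second event says that the primary receiver tolerates some
interference, but too little for the secondary target.

By rotation invariance of the complex Gaussian law, `Y` is `Γ(L - 1, 1)`-distributed and independent
of `(h_x, U)`, and `g_x ~ Γ(L, 1)` is independent of `ε`; moreover `g_p` is exponential and
independent of `(Y, Z)`. Conditionally on `(Y, Z)` the outage probability is
`1_{Y ≤ a} + 1_{Y > a} e^{-b} (1 - e^{-b Z / Y})`, and since `Y > a` on the second event,
`1 - e^{-x} = x + O(x²)` gives the expansion with an error of order `E[Z²] = O(E[ε²])`. The assumed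
law of `ε` on `[0, δ]` yields `E[ε] = (L - 1) / L · δ` and `E[ε²] ≤ δ²`.
-/

section Independence
variable {Ω 𝓧 𝓨 𝓩 : Type*} [MeasurableSpace Ω] [MeasurableSpace 𝓧] [MeasurableSpace 𝓨]
  [MeasurableSpace 𝓩] {μ : Measure Ω} {κ : Measure 𝓧} {X : Ω → 𝓧} {Y : Ω → 𝓨} {Z : Ω → 𝓩}

theorem indepFun_comp_iff_of_hasLaw {f : 𝓧 → 𝓨} {g : 𝓧 → 𝓩} (hX : HasLaw X κ μ)
    (hf : Measurable f) (hg : Measurable g) :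
    IndepFun (fun ω ↦ f (X ω)) (fun ω ↦ g (X ω)) μ ↔ IndepFun f g κ := by
  have hnull {S : Set 𝓧} (hS : MeasurableSet S) : μ (X ⁻¹' S) = κ S := by
    rw [← hX.map_eq, Measure.map_apply_of_aemeasurable hX.aemeasurable hS]
  rw [indepFun_iff_measure_inter_preimage_eq_mul, indepFun_iff_measure_inter_preimage_eq_mul]
  refine forall₄_congr fun A B hA hB ↦ ?_
  rw [← hnull (hf hA), ← hnull (hg hB), ← hnull ((hf hA).inter (hg hB))]
  rfl

theorem indepFun_prodMk_right [IsProbabilityMeasure μ] (hX : AEMeasurable X μ)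
    (hY : AEMeasurable Y μ) (hZ : AEMeasurable Z μ)
    (hXY : IndepFun X Y μ) (hXYZ : IndepFun (fun ω ↦ (X ω, Y ω)) Z μ) :
    IndepFun X (fun ω ↦ (Y ω, Z ω)) μ := by
  have := Measure.isProbabilityMeasure_map hX
  have := Measure.isProbabilityMeasure_map hY
  have := Measure.isProbabilityMeasure_map hZ
  have hYZ : IndepFun Y Z μ := hXYZ.comp measurable_snd measurable_id
  rw [indepFun_iff_map_prod_eq_prod_map_map hX (hY.prodMk hZ),
    (indepFun_iff_map_prod_eq_prod_map_map hY hZ).1 hYZ,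
    ← (measurePreserving_prodAssoc _ _ _).map_eq,
    ← (indepFun_iff_map_prod_eq_prod_map_map hX hY).1 hXY,
    ← (indepFun_iff_map_prod_eq_prod_map_map (hX.prodMk hY) hZ).1 hXYZ,
    AEMeasurable.map_map_of_aemeasurable (by fun_prop) ((hX.prodMk hY).prodMk hZ)]
  rfl

theorem hasLaw_and_indepFun_of_ae_hasLaw [IsProbabilityMeasure μ] {ρ : Measure 𝓩}
    [IsProbabilityMeasure ρ] [SFinite κ] {g : 𝓨 → 𝓧 → 𝓩}
    (hX : HasLaw X κ μ) (hY : AEMeasurable Y μ) (hXY : IndepFun X Y μ)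
    (hg : Measurable (Function.uncurry g)) (hlaw : ∀ᵐ y ∂μ.map Y, HasLaw (g y) ρ κ) :
    HasLaw (fun ω ↦ g (Y ω) (X ω)) ρ μ ∧ IndepFun (fun ω ↦ g (Y ω) (X ω)) Y μ := by
  have hYlaw : HasLaw Y (μ.map Y) μ := ⟨hY, rfl⟩
  have := Measure.isProbabilityMeasure_map hY
  have hskew : MeasurePreserving (fun p : 𝓨 × 𝓧 ↦ (p.1, g p.1 p.2)) ((μ.map Y).prod κ)
      ((μ.map Y).prod ρ) :=
    (MeasurePreserving.id _).skew_product hg (hlaw.mono fun _ h ↦ h.map_eq)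
  have hjoint : HasLaw (fun ω ↦ (Y ω, g (Y ω) (X ω))) ((μ.map Y).prod ρ) μ :=
    hskew.fun_comp_hasLaw (hXY.symm.hasLaw_prod hYlaw hX)
  have hgX : HasLaw (fun ω ↦ g (Y ω) (X ω)) ρ μ := measurePreserving_snd.fun_comp_hasLaw hjoint
  exact ⟨hgX, ((indepFun_iff_hasLaw_prodMk_prod hYlaw hgX).2 hjoint).symm⟩

variable [IsProbabilityMeasure κ] {S : Set (𝓧 × 𝓨)}

theorem integrable_measureReal_section [IsFiniteMeasure μ] (hY : AEMeasurable Y μ)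
    (hS : MeasurableSet S) : Integrable (fun ω ↦ κ.real {x | (x, Y ω) ∈ S}) μ := by
  refine .of_bound ((measurable_measure_prodMk_right hS).ennreal_toReal.comp_aemeasurable
    hY).aestronglyMeasurable 1 (.of_forall fun ω ↦ ?_)
  rw [Real.norm_of_nonneg measureReal_nonneg]
  exact measureReal_le_one

theorem measureReal_eq_integral_section_of_indepFun [IsProbabilityMeasure μ]
    (hX : HasLaw X κ μ) (hY : AEMeasurable Y μ) (hXY : IndepFun X Y μ) (hS : MeasurableSet S) :
    μ.real {ω | (X ω, Y ω) ∈ S} = ∫ ω, κ.real {x | (x, Y ω) ∈ S} ∂μ := by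
  have hsection := measurable_measure_prodMk_right (μ := κ) hS
  have hmap : μ.map (fun ω ↦ (X ω, Y ω)) = κ.prod (μ.map Y) := by
    rw [(indepFun_iff_map_prod_eq_prod_map_map hX.aemeasurable hY).1 hXY, hX.map_eq]
  have := Measure.isProbabilityMeasure_map hY
  calc μ.real {ω | (X ω, Y ω) ∈ S} = (κ.prod (μ.map Y)).real S := by
        rw [← hmap, map_measureReal_apply_of_aemeasurable (hX.aemeasurable.prodMk hY) hS]
        rfl
    _ = ∫ w, κ.real {x | (x, w) ∈ S} ∂μ.map Y := by
        rw [measureReal_def, Measure.prod_apply_symm hS, ← integral_toReal hsection.aemeasurable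
          (.of_forall fun w ↦ measure_lt_top _ _)]
        rfl
    _ = ∫ ω, κ.real {x | (x, Y ω) ∈ S} ∂μ :=
        integral_map hY hsection.ennreal_toReal.aestronglyMeasurable

end Independence

section GammaMeasure
open Real Set

theorem gammaMeasure_eq_withDensity_restrict (a r : ℝ) :
    gammaMeasure a r = (volume.restrict (Ioi 0)).withDensity
      (fun t ↦ ENNReal.ofReal (r ^ a / Gamma a * t ^ (a - 1) * exp (-(r * t)))) := by
  rw [← withDensity_indicator measurableSet_Ioi, gammaMeasure]
  refine withDensity_congr_ae ?_
  filter_upwards [Measure.ae_ne volume (0 : ℝ)] with t ht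
  rcases ht.lt_or_gt with h | h
  · rw [gammaPDF_of_neg h, indicator_of_notMem (notMem_Ioi.2 h.le)]
  · rw [gammaPDF_of_nonneg h.le, indicator_of_mem (mem_Ioi.2 h)]

theorem lintegral_Ioi_comp_sq_div_two (g : ℝ → ENNReal) :
    ∫⁻ r in Ioi (0 : ℝ), ENNReal.ofReal r * g (r ^ 2 / 2) = ∫⁻ t in Ioi (0 : ℝ), g t := by
  have himage : (fun r : ℝ ↦ r ^ 2 / 2) '' Ioi 0 = Ioi 0 := by
    refine Subset.antisymm ?_ fun t (ht : 0 < t) ↦ ⟨√(2 * t), sqrt_pos.2 (by positivity), ?_⟩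
    · rintro _ ⟨r, hr : 0 < r, rfl⟩
      exact div_pos (pow_pos hr 2) two_pos
    · simp only [sq_sqrt (mul_nonneg zero_le_two ht.le), mul_div_cancel_left₀ t two_ne_zero]
  have hinj : InjOn (fun r : ℝ ↦ r ^ 2 / 2) (Ioi 0) := fun r (hr : 0 < r) q (hq : 0 < q) h ↦
    (sq_eq_sq₀ hr.le hq.le).1 ((div_left_inj' two_ne_zero).1 h)
  have hderiv : ∀ r ∈ Ioi (0 : ℝ), HasDerivWithinAt (fun r ↦ r ^ 2 / 2) r (Ioi 0) r := fun r _ ↦ by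
    simpa using ((hasDerivAt_pow 2 r).div_const 2).hasDerivWithinAt
  conv_rhs =>
    rw [← himage, lintegral_image_eq_lintegral_abs_deriv_mul measurableSet_Ioi hderiv hinj]
  exact setLIntegral_congr_fun measurableSet_Ioi fun r (hr : 0 < r) ↦ by
    simp only [abs_of_pos hr]

theorem lintegral_gammaMeasure_half {n : ℕ} (hn : 0 < n) {g : ℝ → ENNReal} (hg : Measurable g) :
    ∫⁻ t, g t ∂gammaMeasure (n / 2) 1 =
      ENNReal.ofReal (2 ^ (1 - n / 2 : ℝ) / Gamma (n / 2)) *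
        ∫⁻ r in Ioi (0 : ℝ), ENNReal.ofReal (r ^ (n - 1) * exp (-r ^ 2 / 2)) * g (r ^ 2 / 2) := by
  rw [gammaMeasure_eq_withDensity_restrict,
    lintegral_withDensity_eq_lintegral_mul _ (by fun_prop) hg, ← lintegral_Ioi_comp_sq_div_two,
    ← lintegral_const_mul' _ _ ENNReal.ofReal_ne_top]
  refine setLIntegral_congr_fun measurableSet_Ioi fun r (hr : 0 < r) ↦ ?_
  have hpow : r ^ (n - 1) = 2 ^ (n / 2 - 1 : ℝ) * ((r ^ 2 / 2) ^ (n / 2 - 1 : ℝ) * r) := by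
    rw [div_rpow (by positivity) zero_le_two, ← rpow_natCast r 2, ← rpow_mul hr.le, ← mul_assoc,
      mul_div_cancel₀ _ (by positivity), ← rpow_add_one hr.ne', ← rpow_natCast, Nat.cast_sub hn]
    congr 1
    push_cast
    ring
  have htwo : (2 : ℝ) ^ (1 - n / 2 : ℝ) * 2 ^ (n / 2 - 1 : ℝ) = 1 := by
    rw [← rpow_add two_pos, sub_add_sub_cancel', sub_self, rpow_zero]
  simp only [Pi.mul_apply]
  rw [← mul_assoc, ← mul_assoc, ← ENNReal.ofReal_mul hr.le, ← ENNReal.ofReal_mul (by positivity)]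
  congr 2
  rw [hpow, one_rpow, one_mul, neg_div]
  linear_combination (norm := (field_simp; ring)) (-(r * (r ^ 2 / 2) ^ (n / 2 - 1 : ℝ) *
    exp (-(r ^ 2 / 2)) / Gamma (n / 2))) * htwo

end GammaMeasure

section StdGaussian
open Real Set Module

variable {E : Type*} [NormedAddCommGroup E] [InnerProductSpace ℝ E] [FiniteDimensional ℝ E]
  [MeasurableSpace E] [BorelSpace E]

theorem stdGaussian_eq_withDensity :
    stdGaussian E = volume.withDensity (fun x ↦
      ENNReal.ofReal ((2 * π) ^ (-(finrank ℝ E / 2 : ℝ)) * exp (-‖x‖ ^ 2 / 2))) := by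
  set c : ℝ := (2 * π) ^ (-(finrank ℝ E / 2 : ℝ))
  have hint : Integrable (fun x : E ↦ c * exp (-‖x‖ ^ 2 / 2)) := by
    refine Integrable.const_mul ?_ _
    refine (GaussianFourier.integrable_cexp_neg_mul_sq_norm_add (V := E) (b := 1 / 2)
      (by norm_num) 0 0).norm.congr (.of_forall fun x ↦ ?_)
    simp [Complex.norm_exp, ← Complex.ofReal_pow, div_eq_inv_mul]
  have : IsFiniteMeasure (volume.withDensity
      (fun x : E ↦ ENNReal.ofReal (c * exp (-‖x‖ ^ 2 / 2)))) :=
    isFiniteMeasure_withDensity_ofReal hint.2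
  refine Measure.ext_of_charFun (funext fun t ↦ ?_)
  have hfourier := GaussianFourier.integral_cexp_neg_mul_sq_norm_add (V := E) (b := 1 / 2)
    (by norm_num) Complex.I t
  have hc : (c : ℂ) * ((π : ℂ) / (1 / 2)) ^ (finrank ℝ E / 2 : ℂ) = 1 := by
    have h : ((π : ℂ) / (1 / 2)) ^ (finrank ℝ E / 2 : ℂ) =
        ((2 * π) ^ (finrank ℝ E / 2 : ℝ) : ℝ) := by
      rw [Complex.ofReal_cpow (by positivity)]
      push_cast
      congr 1
      ring
    rw [h, ← Complex.ofReal_mul, ← rpow_add (by positivity), neg_add_cancel, rpow_zero,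
      Complex.ofReal_one]
  calc charFun (stdGaussian E) t
      = c * ∫ x : E, Complex.exp (-(1 / 2) * ‖x‖ ^ 2 + Complex.I * inner ℝ t x) := by
        rw [charFun_stdGaussian, hfourier, ← mul_assoc, hc, one_mul, Complex.I_sq]
        congr 1
        ring
    _ = _ := by
        rw [charFun_apply, integral_withDensity_eq_integral_toReal_smul (by fun_prop) (by simp),
          ← integral_const_mul]
        refine integral_congr_ae (.of_forall fun x ↦ ?_)
        simp only
        rw [ENNReal.toReal_ofReal (by positivity), Complex.real_smul, Complex.exp_add,
          real_inner_comm, mul_comm Complex.I]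
        push_cast
        ring_nf

theorem lintegral_norm_mul_normalize_addHaar [Nontrivial E] (ν : Measure E) [ν.IsAddHaarMeasure]
    {g : ℝ → ENNReal} {φ : E → ENNReal} (hg : Measurable g) (hφ : Measurable φ) :
    ∫⁻ x, g ‖x‖ * φ (NormedSpace.normalize x) ∂ν =
      (∫⁻ x : Metric.sphere (0 : E) 1, φ x ∂ν.toSphere) *
        ∫⁻ r in Ioi (0 : ℝ), ENNReal.ofReal (r ^ (finrank ℝ E - 1)) * g r := by
  calc ∫⁻ x, g ‖x‖ * φ (NormedSpace.normalize x) ∂ν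
      = ∫⁻ x : ({0}ᶜ : Set E), g ‖x.1‖ * φ (NormedSpace.normalize x.1) ∂ν.comap (↑) := by
        rw [lintegral_subtype_comap (measurableSet_singleton _).compl
          fun x ↦ g ‖x‖ * φ (NormedSpace.normalize x), restrict_compl_singleton]
    _ = ∫⁻ x, φ x.1 * g x.2 ∂ν.toSphere.prod (.volumeIoiPow (finrank ℝ E - 1)) := by
        rw [← ν.measurePreserving_homeomorphUnitSphereProd.lintegral_comp_emb
          (Homeomorph.measurableEmbedding _)]
        simp [mul_comm, NormedSpace.normalize]
    _ = (∫⁻ x : Metric.sphere (0 : E) 1, φ x ∂ν.toSphere) *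
          ∫⁻ r : Ioi (0 : ℝ), g r ∂.volumeIoiPow (finrank ℝ E - 1) :=
        lintegral_prod_mul (hφ.comp measurable_subtype_coe).aemeasurable
          (hg.comp measurable_subtype_coe).aemeasurable
    _ = _ := by
        rw [Measure.volumeIoiPow, lintegral_withDensity_eq_lintegral_mul _ (by fun_prop)
          (by fun_prop)]
        congr 1
        exact lintegral_subtype_comap measurableSet_Ioi
          (fun r ↦ ENNReal.ofReal (r ^ (finrank ℝ E - 1)) * g r)

theorem measurable_normalize : Measurable (NormedSpace.normalize : E → E) := by
  unfold NormedSpace.normalize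
  fun_prop

theorem indepFun_norm_normalize [Nontrivial E] (ν : Measure E) [ν.IsAddHaarMeasure]
    {f : ℝ → ENNReal} (hf : Measurable f)
    [IsProbabilityMeasure (ν.withDensity fun x ↦ f ‖x‖)] :
    IndepFun (fun x ↦ ‖x‖) NormedSpace.normalize (ν.withDensity fun x ↦ f ‖x‖) := by
  set μ := ν.withDensity fun x ↦ f ‖x‖ with hμ
  let radial (A : Set ℝ) : ENNReal :=
    ∫⁻ r in Ioi (0 : ℝ), ENNReal.ofReal (r ^ (finrank ℝ E - 1)) * (f r * A.indicator 1 r)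
  let angular (B : Set E) : ENNReal :=
    ∫⁻ x : Metric.sphere (0 : E) 1, B.indicator 1 (x : E) ∂ν.toSphere
  have hpolar : ∀ A B, MeasurableSet A → MeasurableSet B →
      μ ((‖·‖) ⁻¹' A ∩ NormedSpace.normalize ⁻¹' B) = angular B * radial A := by
    intro A B hA hB
    have hAB : MeasurableSet ((‖·‖) ⁻¹' A ∩ NormedSpace.normalize ⁻¹' B : Set E) :=
      (measurable_norm hA).inter (measurable_normalize hB)
    refine Eq.trans ?_ (lintegral_norm_mul_normalize_addHaar ν
      (g := fun r ↦ f r * A.indicator 1 r) (hf.mul (measurable_one.indicator hA))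
      (measurable_one.indicator hB))
    rw [hμ, withDensity_apply _ hAB, ← lintegral_indicator hAB]
    refine lintegral_congr fun x ↦ ?_
    by_cases h1 : ‖x‖ ∈ A <;> by_cases h2 : NormedSpace.normalize x ∈ B <;> simp [h1, h2]
  have htotal : angular univ * radial univ = 1 := by
    rw [← hpolar univ univ .univ .univ]
    simp
  refine indepFun_iff_measure_inter_preimage_eq_mul.2 fun A B hA hB ↦ ?_
  have hnorm : μ ((‖·‖) ⁻¹' A) = angular univ * radial A := by
    simpa using hpolar A univ hA .univ
  have hdir : μ (NormedSpace.normalize ⁻¹' B) = angular B * radial univ := by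
    simpa using hpolar univ B .univ hB
  calc μ ((‖·‖) ⁻¹' A ∩ NormedSpace.normalize ⁻¹' B)
      = angular B * radial A * (angular univ * radial univ) := by
        rw [hpolar A B hA hB, htotal, mul_one]
    _ = μ ((‖·‖) ⁻¹' A) * μ (NormedSpace.normalize ⁻¹' B) := by
        rw [hnorm, hdir]
        ring

theorem lintegral_stdGaussian_comp_norm [Nontrivial E] {g : ℝ → ENNReal} (hg : Measurable g) :
    ∫⁻ x, g ‖x‖ ∂stdGaussian E =
      ENNReal.ofReal ((2 * π) ^ (-(finrank ℝ E / 2 : ℝ))) * (volume : Measure E).toSphere univ *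
        ∫⁻ r in Ioi (0 : ℝ), ENNReal.ofReal (r ^ (finrank ℝ E - 1) * exp (-r ^ 2 / 2)) * g r := by
  have hpolar := lintegral_norm_mul_normalize_addHaar (volume : Measure E) (φ := 1)
    (g := fun r ↦ ENNReal.ofReal (exp (-r ^ 2 / 2)) * g r) (by fun_prop) measurable_one
  simp only [Pi.one_apply, mul_one, lintegral_const, one_mul, ← mul_assoc] at hpolar
  rw [stdGaussian_eq_withDensity, lintegral_withDensity_eq_lintegral_mul _ (by fun_prop)
    (by fun_prop), mul_assoc]
  simp only [Pi.mul_apply, ENNReal.ofReal_mul (rpow_nonneg two_pi_pos.le _), mul_assoc]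
  rw [lintegral_const_mul' _ _ ENNReal.ofReal_ne_top]
  simp only [← mul_assoc]
  rw [mul_assoc, hpolar]
  congr 2
  refine setLIntegral_congr_fun measurableSet_Ioi fun r (hr : 0 < r) ↦ ?_
  rw [ENNReal.ofReal_mul (by positivity)]

theorem map_normSq_div_two_stdGaussian [Nontrivial E] :
    (stdGaussian E).map (fun x ↦ ‖x‖ ^ 2 / 2) = gammaMeasure (finrank ℝ E / 2) 1 := by
  have hd : 0 < finrank ℝ E := finrank_pos
  have := isProbabilityMeasure_gammaMeasure (a := (finrank ℝ E / 2 : ℝ)) (by positivity) one_pos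
  set c := ENNReal.ofReal ((2 * π) ^ (-(finrank ℝ E / 2 : ℝ))) *
    (volume : Measure E).toSphere univ
  set c' := ENNReal.ofReal (2 ^ (1 - finrank ℝ E / 2 : ℝ) / Gamma (finrank ℝ E / 2))
  set w : ℝ → ENNReal := fun r ↦ ENNReal.ofReal (r ^ (finrank ℝ E - 1) * exp (-r ^ 2 / 2))
  have hgauss (g : ℝ → ENNReal) (hg : Measurable g) :
      ∫⁻ x, g (‖x‖ ^ 2 / 2) ∂stdGaussian E = c * ∫⁻ r in Ioi (0 : ℝ), w r * g (r ^ 2 / 2) :=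
    lintegral_stdGaussian_comp_norm (g := fun r ↦ g (r ^ 2 / 2)) (by fun_prop)
  have hgamma (g : ℝ → ENNReal) (hg : Measurable g) :
      ∫⁻ t, g t ∂gammaMeasure (finrank ℝ E / 2) 1 =
        c' * ∫⁻ r in Ioi (0 : ℝ), w r * g (r ^ 2 / 2) :=
    lintegral_gammaMeasure_half hd hg
  -- both laws have total mass one, hence the two normalizing constants agree
  have hc : c * ∫⁻ r in Ioi (0 : ℝ), w r = 1 := by
    simpa using (hgauss 1 measurable_one).symm
  have hc' : c' * ∫⁻ r in Ioi (0 : ℝ), w r = 1 := by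
    simpa using (hgamma 1 measurable_one).symm
  refine Measure.ext_of_lintegral _ fun g hg ↦ ?_
  rw [lintegral_map hg (by fun_prop), hgauss g hg, hgamma g hg]
  congr 1
  calc c = c * (c' * ∫⁻ r in Ioi (0 : ℝ), w r) := by rw [hc', mul_one]
    _ = c' * (c * ∫⁻ r in Ioi (0 : ℝ), w r) := by ring
    _ = c' := by rw [hc, mul_one]

theorem map_orthogonalProjectionOnto_stdGaussian (W : Submodule ℝ E) :
    (stdGaussian E).map W.orthogonalProjectionOnto = stdGaussian W := by
  have := Measure.isProbabilityMeasure_map (μ := stdGaussian E)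
    W.orthogonalProjectionOnto.continuous.measurable.aemeasurable
  refine Measure.ext_of_charFun (funext fun t ↦ ?_)
  calc charFun ((stdGaussian E).map W.orthogonalProjectionOnto) t
      = charFun (stdGaussian E) (t : E) := by
        rw [charFun_apply, charFun_apply, integral_map
          W.orthogonalProjectionOnto.continuous.measurable.aemeasurable
          (Measurable.aestronglyMeasurable (by fun_prop))]
        simp only [Submodule.coe_inner, ← Submodule.starProjection_apply,
          Submodule.inner_starProjection_left_eq_right, Submodule.starProjection_eq_self_iff.2 t.2]
    _ = charFun (stdGaussian W) t := by simp only [charFun_stdGaussian, Submodule.norm_coe]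

variable {s : ℝ}

theorem eq_map_smul_stdGaussian_of_charFun {μ : Measure E} [IsFiniteMeasure μ] (hs : 0 ≤ s)
    (hμ : ∀ t, charFun μ t = Complex.exp (-(s / 4) * ‖t‖ ^ 2)) :
    μ = (stdGaussian E).map (√(s / 2) • ·) := by
  refine Measure.ext_of_charFun (funext fun t ↦ ?_)
  rw [charFun_map_smul, charFun_stdGaussian, hμ, norm_smul, norm_of_nonneg (sqrt_nonneg _)]
  congr 1
  rw [Complex.ofReal_mul, mul_pow, ← Complex.ofReal_pow √(s / 2), sq_sqrt (by positivity)]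
  push_cast
  ring

theorem map_normSq_div_map_smul_stdGaussian [Nontrivial E] (hs : 0 < s) :
    ((stdGaussian E).map (√(s / 2) • ·)).map (fun x ↦ ‖x‖ ^ 2 / s) =
      gammaMeasure (finrank ℝ E / 2) 1 := by
  rw [Measure.map_map (by fun_prop) (by fun_prop), ← map_normSq_div_two_stdGaussian]
  congr 1
  funext x
  rw [Function.comp_apply, norm_smul, norm_of_nonneg (sqrt_nonneg _), mul_pow,
    sq_sqrt (by positivity)]
  field_simp

theorem map_normSq_orthogonalProjectionOnto_div (W : Submodule ℝ E) [Nontrivial W] (hs : 0 < s) :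
    ((stdGaussian E).map (√(s / 2) • ·)).map (fun x ↦ ‖W.orthogonalProjectionOnto x‖ ^ 2 / s) =
      gammaMeasure (finrank ℝ W / 2) 1 := by
  have hP : Measurable W.orthogonalProjectionOnto :=
    W.orthogonalProjectionOnto.continuous.measurable
  rw [← map_normSq_div_map_smul_stdGaussian hs, ← map_orthogonalProjectionOnto_stdGaussian,
    Measure.map_map (by fun_prop) (by fun_prop), Measure.map_map (by fun_prop) hP,
    Measure.map_map (by fun_prop) (by fun_prop)]
  congr 1
  funext x
  simp only [Function.comp_apply, map_smul]

theorem indepFun_norm_normalize_map_smul_stdGaussian [Nontrivial E] (hs : 0 < s) :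
    IndepFun (fun x ↦ ‖x‖) NormedSpace.normalize ((stdGaussian E).map (√(s / 2) • ·)) := by
  have hX : HasLaw (fun x : E ↦ √(s / 2) • x) ((stdGaussian E).map (√(s / 2) • ·))
    (stdGaussian E) := ⟨by fun_prop, rfl⟩
  have hstd : IndepFun (fun x : E ↦ ‖x‖) NormedSpace.normalize (stdGaussian E) := by
    have : IsProbabilityMeasure (volume.withDensity fun x : E ↦
        ENNReal.ofReal ((2 * π) ^ (-(finrank ℝ E / 2 : ℝ)) * exp (-‖x‖ ^ 2 / 2))) := by
      rw [← stdGaussian_eq_withDensity]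
      infer_instance
    rw [stdGaussian_eq_withDensity]
    exact indepFun_norm_normalize volume (f := fun r ↦
      ENNReal.ofReal ((2 * π) ^ (-(finrank ℝ E / 2 : ℝ)) * exp (-r ^ 2 / 2))) (by fun_prop)
  refine (indepFun_comp_iff_of_hasLaw hX measurable_norm measurable_normalize).1 ?_
  simp only [norm_smul, NormedSpace.normalize_smul_of_pos (sqrt_pos.2 (half_pos hs))]
  exact hstd.comp (measurable_const_mul _) measurable_id

end StdGaussian

section GammaMoments
open Real Set

variable {a x : ℝ}

theorem ae_pos_gammaMeasure (a r : ℝ) : ∀ᵐ t ∂gammaMeasure a r, 0 < t := by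
  rw [gammaMeasure_eq_withDensity_restrict]
  exact (withDensity_absolutelyContinuous _ _).ae_le (ae_restrict_mem measurableSet_Ioi)

theorem setIntegral_Ioi_rpow_gammaMeasure (ha : 0 < a) (hx : 0 ≤ x) (k : ℝ) :
    ∫ t in Ioi x, t ^ k ∂gammaMeasure a 1 = upperGamma (a + k) x / Gamma a := by
  rw [gammaMeasure_eq_withDensity_restrict, restrict_withDensity measurableSet_Ioi,
    Measure.restrict_restrict measurableSet_Ioi, Ioi_inter_Ioi, max_eq_left hx,
    integral_withDensity_eq_integral_toReal_smul (by fun_prop) (by simp), upperGamma,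
    ← integral_div]
  refine setIntegral_congr_fun measurableSet_Ioi fun t (ht : x < t) ↦ ?_
  have ht : 0 < t := hx.trans_lt ht
  simp only [one_rpow, one_mul]
  rw [ENNReal.toReal_ofReal (by positivity), smul_eq_mul, add_sub_right_comm, rpow_add ht]
  ring

theorem measureReal_Iic_gammaMeasure (ha : 0 < a) (hx : 0 ≤ x) :
    (gammaMeasure a 1).real (Iic x) = 1 - upperGamma a x / Gamma a := by
  have := isProbabilityMeasure_gammaMeasure ha one_pos
  rw [← compl_Ioi, probReal_compl_eq_one_sub measurableSet_Ioi]
  simpa using setIntegral_Ioi_rpow_gammaMeasure ha hx 0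

theorem setIntegral_Ioi_inv_gammaMeasure (ha : 0 < a) (hx : 0 ≤ x) :
    ∫ t in Ioi x, t⁻¹ ∂gammaMeasure a 1 = upperGamma (a - 1) x / Gamma a := by
  simpa only [rpow_neg_one, sub_eq_add_neg] using setIntegral_Ioi_rpow_gammaMeasure ha hx (-1)

theorem integral_rpow_gammaMeasure {k : ℝ} (ha : 0 < a) (hk : 0 < a + k) :
    ∫ t, t ^ k ∂gammaMeasure a 1 = Gamma (a + k) / Gamma a := by
  rw [← Measure.restrict_eq_self_of_ae_mem (ae_pos_gammaMeasure a 1)]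
  refine (setIntegral_Ioi_rpow_gammaMeasure ha le_rfl k).trans ?_
  rw [upperGamma, Gamma_eq_integral hk]
  simp only [mul_comm]

theorem integral_id_gammaMeasure (ha : 0 < a) : ∫ t, t ∂gammaMeasure a 1 = a := by
  have h := integral_rpow_gammaMeasure (k := 1) ha (by positivity)
  simpa only [rpow_one, Gamma_add_one ha.ne', mul_div_cancel_right₀ a (Gamma_pos_of_pos ha).ne']
    using h

theorem integral_sq_gammaMeasure (ha : 0 < a) :
    ∫ t, t ^ 2 ∂gammaMeasure a 1 = a * (a + 1) := by
  have h := integral_rpow_gammaMeasure (k := 2) ha (by positivity)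
  have hΓ : Gamma (a + 2) = a * (a + 1) * Gamma a := by
    rw [← one_add_one_eq_two, ← add_assoc, Gamma_add_one (by positivity), Gamma_add_one ha.ne']
    ring
  simpa only [rpow_two, hΓ, mul_div_cancel_right₀ _ (Gamma_pos_of_pos ha).ne'] using h

theorem integrable_sq_gammaMeasure (ha : 0 < a) : Integrable (fun t ↦ t ^ 2) (gammaMeasure a 1) :=
  .of_integral_ne_zero (by rw [integral_sq_gammaMeasure ha]; positivity)

end GammaMoments

section ComplexGaussian
open Real

variable {L : ℕ} {s : ℝ}

instance isProbabilityMeasure_complexGaussian (s : ℝ) : IsProbabilityMeasure (complexGaussian s) :=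
  Measure.isProbabilityMeasure_map Complex.measurableEquivRealProd.symm.measurable.aemeasurable

instance isProbabilityMeasure_complexGaussianVector (L : ℕ) (s : ℝ) :
    IsProbabilityMeasure (complexGaussianVector L s) :=
  Measure.isProbabilityMeasure_map (by fun_prop)

theorem charFun_complexGaussian (hs : 0 ≤ s) (t : ℂ) :
    charFun (complexGaussian s) t = Complex.exp (-(s / 4) * ‖t‖ ^ 2) := by
  have hfactor (z : ℝ × ℝ) : Complex.exp ((inner ℝ (⟨z.1, z.2⟩ : ℂ) t : ℝ) * Complex.I) =
      Complex.exp (t.re * z.1 * Complex.I) * Complex.exp (t.im * z.2 * Complex.I) := by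
    rw [← Complex.exp_add, Complex.inner]
    congr 1
    simp
    ring
  have hmk : Measurable fun z : ℝ × ℝ ↦ (⟨z.1, z.2⟩ : ℂ) :=
    Complex.measurableEquivRealProd.symm.measurable
  rw [charFun_apply, complexGaussian, integral_map hmk.aemeasurable
      (Measurable.aestronglyMeasurable (by fun_prop))]
  simp_rw [hfactor]
  rw [integral_prod_mul (fun x : ℝ ↦ Complex.exp (t.re * x * Complex.I))
    (fun x : ℝ ↦ Complex.exp (t.im * x * Complex.I)), ← charFun_apply_real,
    ← charFun_apply_real, charFun_gaussianReal, charFun_gaussianReal, ← Complex.exp_add,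
    ← Complex.ofReal_pow ‖t‖, ← Complex.normSq_eq_norm_sq, Complex.normSq_apply,
    coe_toNNReal _ (by positivity)]
  congr 1
  push_cast
  ring

theorem charFun_complexGaussianVector (hs : 0 ≤ s) (t : EuclideanSpace ℂ (Fin L)) :
    charFun (complexGaussianVector L s) t = Complex.exp (-(s / 4) * ‖t‖ ^ 2) := by
  rw [complexGaussianVector, charFun_pi]
  simp_rw [charFun_complexGaussian hs]
  rw [← Complex.exp_sum, ← Complex.ofReal_pow, EuclideanSpace.norm_sq_eq, ← Finset.mul_sum]
  push_cast
  rfl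

theorem complexGaussian_eq_map_smul_stdGaussian (hs : 0 ≤ s) :
    complexGaussian s = (stdGaussian ℂ).map (√(s / 2) • ·) :=
  eq_map_smul_stdGaussian_of_charFun hs (charFun_complexGaussian hs)

theorem complexGaussianVector_eq_map_smul_stdGaussian (hs : 0 ≤ s) :
    complexGaussianVector L s = (stdGaussian (EuclideanSpace ℂ (Fin L))).map (√(s / 2) • ·) :=
  eq_map_smul_stdGaussian_of_charFun hs (charFun_complexGaussianVector hs)

theorem hasLaw_normSq_div_complexGaussian (hs : 0 < s) :
    HasLaw (fun z ↦ ‖z‖ ^ 2 / s) (expMeasure 1) (complexGaussian s) := by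
  refine ⟨by fun_prop, ?_⟩
  rw [complexGaussian_eq_map_smul_stdGaussian hs.le, map_normSq_div_map_smul_stdGaussian hs,
    Complex.finrank_real_complex, Nat.cast_ofNat, div_self two_ne_zero]
  rfl

theorem hasLaw_normSq_div_complexGaussianVector [NeZero L] (hs : 0 < s) :
    HasLaw (fun h ↦ ‖h‖ ^ 2 / s) (gammaMeasure L 1) (complexGaussianVector L s) := by
  refine ⟨by fun_prop, ?_⟩
  rw [complexGaussianVector_eq_map_smul_stdGaussian hs.le, map_normSq_div_map_smul_stdGaussian hs,
    finrank_real_of_complex, finrank_euclideanSpace_fin, Nat.cast_mul, Nat.cast_ofNat,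
    mul_div_cancel_left₀ _ two_ne_zero]

theorem indepFun_norm_normalize_complexGaussianVector [NeZero L] (hs : 0 < s) :
    IndepFun (fun h ↦ ‖h‖) NormedSpace.normalize (complexGaussianVector L s) := by
  rw [complexGaussianVector_eq_map_smul_stdGaussian hs.le]
  exact indepFun_norm_normalize_map_smul_stdGaussian hs

end ComplexGaussian

section OrthogonalPower
open Module

/-- The squared norm of the component of `h` orthogonal to the unit vector `v`. -/
noncomputable def orthogonalPower {F : Type*} [NormedAddCommGroup F] [InnerProductSpace ℂ F]
    (v h : F) : ℝ :=
  ‖h‖ ^ 2 - ‖inner ℂ v h‖ ^ 2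

section InnerProductSpace

variable {F : Type*} [NormedAddCommGroup F] [InnerProductSpace ℂ F] {v : F}

theorem inner_sub_inner_smul_eq_zero (hv : ‖v‖ = 1) (h : F) :
    inner ℂ v (h - inner ℂ v h • v) = 0 := by
  rw [inner_sub_right, inner_smul_right, inner_self_eq_norm_sq_to_K, hv]
  simp

theorem orthogonalPower_eq_norm_sub_sq (hv : ‖v‖ = 1) (h : F) :
    orthogonalPower v h = ‖h - inner ℂ v h • v‖ ^ 2 := by
  rw [orthogonalPower, norm_sub_sq (𝕜 := ℂ), inner_smul_right, ← inner_conj_symm h v, norm_smul, hv,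
    mul_one, RCLike.mul_conj]
  norm_cast
  ring

theorem orthogonalPower_nonneg (hv : ‖v‖ = 1) (h : F) : 0 ≤ orthogonalPower v h := by
  rw [orthogonalPower_eq_norm_sub_sq hv]
  positivity

theorem orthogonalPower_smul (c : ℂ) (v h : F) :
    orthogonalPower v (c • h) = ‖c‖ ^ 2 * orthogonalPower v h := by
  simp only [orthogonalPower, inner_smul_right, norm_smul, norm_mul]
  ring

end InnerProductSpace

variable {L : ℕ} {s : ℝ} {v : EuclideanSpace ℂ (Fin L)}

theorem measurable_orthogonalPower {α : Type*} [MeasurableSpace α]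
    {u h : α → EuclideanSpace ℂ (Fin L)} (hu : Measurable u) (hh : Measurable h) :
    Measurable fun x ↦ orthogonalPower (u x) (h x) :=
  (hh.norm.pow_const 2).sub ((hu.inner hh).norm.pow_const 2)

theorem real_inner_euclideanSpace_complex (x y : EuclideanSpace ℂ (Fin L)) :
    inner ℝ x y = (inner ℂ x y).re := by
  simp [PiLp.inner_apply, Complex.inner, mul_comm]

theorem coe_orthogonalProjectionOnto_orthogonal_span_singleton (hv : ‖v‖ = 1)
    (h : EuclideanSpace ℂ (Fin L)) :
    (((ℂ ∙ v)ᗮ.restrictScalars ℝ).orthogonalProjectionOnto h : EuclideanSpace ℂ (Fin L)) =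
      h - inner ℂ v h • v := by
  refine Submodule.eq_starProjection_of_mem_of_inner_eq_zero ?_ fun w hw ↦ ?_
  · rw [Submodule.restrictScalars_mem, Submodule.mem_orthogonal_singleton_iff_inner_right]
    exact inner_sub_inner_smul_eq_zero hv h
  · rw [Submodule.restrictScalars_mem, Submodule.mem_orthogonal_singleton_iff_inner_right] at hw
    rw [sub_sub_cancel, real_inner_euclideanSpace_complex, inner_smul_left, hw, mul_zero,
      Complex.zero_re]

theorem finrank_real_orthogonal_span_singleton (hv : v ≠ 0) :
    finrank ℝ ((ℂ ∙ v)ᗮ.restrictScalars ℝ) = 2 * (L - 1) := by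
  have hL : finrank ℂ (ℂ ∙ v) + finrank ℂ (ℂ ∙ v)ᗮ = L := by
    rw [Submodule.finrank_add_finrank_orthogonal, finrank_euclideanSpace_fin]
  rw [finrank_span_singleton hv] at hL
  calc finrank ℝ ((ℂ ∙ v)ᗮ.restrictScalars ℝ) = 2 * finrank ℂ (ℂ ∙ v)ᗮ :=
        finrank_real_of_complex (ℂ ∙ v)ᗮ
    _ = 2 * (L - 1) := by omega

theorem hasLaw_orthogonalPower_div_complexGaussianVector (hL : 2 ≤ L) (hs : 0 < s)
    (hv : ‖v‖ = 1) :
    HasLaw (fun h ↦ orthogonalPower v h / s) (gammaMeasure (L - 1) 1)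
      (complexGaussianVector L s) := by
  set W := (ℂ ∙ v)ᗮ.restrictScalars ℝ
  have hdim : finrank ℝ W = 2 * (L - 1) :=
    finrank_real_orthogonal_span_singleton (norm_ne_zero_iff.1 (by simp [hv]))
  have : Nontrivial W := nontrivial_of_finrank_pos (R := ℝ) (by omega)
  have hP : Measurable W.orthogonalProjectionOnto :=
    W.orthogonalProjectionOnto.continuous.measurable
  have hpower (h : EuclideanSpace ℂ (Fin L)) :
      orthogonalPower v h = ‖W.orthogonalProjectionOnto h‖ ^ 2 := by
    rw [orthogonalPower_eq_norm_sub_sq hv,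
      ← coe_orthogonalProjectionOnto_orthogonal_span_singleton hv, Submodule.norm_coe]
  simp only [hpower]
  refine ⟨by fun_prop, ?_⟩
  rw [complexGaussianVector_eq_map_smul_stdGaussian hs.le,
    map_normSq_orthogonalProjectionOnto_div W hs, hdim, Nat.cast_mul, Nat.cast_ofNat,
    mul_div_cancel_left₀ _ two_ne_zero, Nat.cast_sub (by omega), Nat.cast_one]

end OrthogonalPower

section Beamforming

variable {L : ℕ} {v s f : EuclideanSpace ℂ (Fin L)} {P : ℝ}

theorem norm_inner_sq_le_of_mem_ocbFeasible (hv : ‖v‖ = 1) (hf : f ∈ ocbFeasible v P) :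
    ‖inner ℂ f s‖ ^ 2 ≤ P * orthogonalPower v s := by
  have hproj : inner ℂ f s = inner ℂ f (s - inner ℂ v s • v) := by
    rw [inner_sub_right, inner_smul_right, hf.1, mul_zero, sub_zero]
  calc ‖inner ℂ f s‖ ^ 2 ≤ (‖f‖ * ‖s - inner ℂ v s • v‖) ^ 2 := by
        rw [hproj]
        gcongr
        exact norm_inner_le_norm _ _
    _ = ‖f‖ ^ 2 * orthogonalPower v s := by rw [mul_pow, orthogonalPower_eq_norm_sub_sq hv]
    _ ≤ P * orthogonalPower v s :=
        mul_le_mul_of_nonneg_right hf.2 (orthogonalPower_nonneg hv s)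

theorem exists_mem_ocbFeasible_norm_inner_sq_eq (hv : ‖v‖ = 1) (hP : 0 ≤ P)
    (s : EuclideanSpace ℂ (Fin L)) :
    ∃ f ∈ ocbFeasible v P, ‖inner ℂ f s‖ ^ 2 = P * orthogonalPower v s := by
  set w := s - inner ℂ v s • v with hw
  have hwv : inner ℂ w v = 0 := inner_eq_zero_symm.1 (inner_sub_inner_smul_eq_zero hv s)
  have hws : inner ℂ w s = (‖w‖ : ℂ) ^ 2 := by
    have hww : inner ℂ w w = (‖w‖ : ℂ) ^ 2 := inner_self_eq_norm_sq_to_K w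
    rw [← hww, inner_sub_right, inner_smul_right, hwv, mul_zero, sub_zero]
  have hr : ‖((√P / ‖w‖ : ℝ) : ℂ)‖ ^ 2 = P / ‖w‖ ^ 2 := by
    rw [Complex.norm_real, Real.norm_eq_abs, sq_abs, div_pow, Real.sq_sqrt hP]
  refine ⟨((√P / ‖w‖ : ℝ) : ℂ) • w, ⟨by rw [inner_smul_left, hwv, mul_zero], ?_⟩, ?_⟩
  · rw [norm_smul, mul_pow, hr]
    rcases eq_or_ne ‖w‖ 0 with h | h
    · simpa [h] using hP
    · exact (div_mul_cancel₀ P (pow_ne_zero 2 h)).le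
  · rw [inner_smul_left, hws, norm_mul, mul_pow, RCLike.norm_conj, hr, norm_pow, Complex.norm_real,
      norm_norm, orthogonalPower_eq_norm_sub_sq hv, ← hw]
    rcases eq_or_ne ‖w‖ 0 with h | h
    · simp [h]
    · field_simp

theorem IsOCB.norm_inner_sq (hf : IsOCB v s P f) (hv : ‖v‖ = 1) (hP : 0 ≤ P) :
    ‖inner ℂ f s‖ ^ 2 = P * orthogonalPower v s := by
  obtain ⟨w, hw, hws⟩ := exists_mem_ocbFeasible_norm_inner_sq_eq hv hP s
  exact le_antisymm (norm_inner_sq_le_of_mem_ocbFeasible hv hf.1) (hws ▸ hf.2 hw)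

theorem channelShape_eq_normalize (h : EuclideanSpace ℂ (Fin L)) :
    channelShape h = NormedSpace.normalize h := by
  rw [channelShape, NormedSpace.normalize, Complex.coe_smul]

theorem measurable_channelShape :
    Measurable (channelShape : EuclideanSpace ℂ (Fin L) → EuclideanSpace ℂ (Fin L)) := by
  unfold channelShape
  fun_prop

theorem normSq_mul_orthogonalPower_channelShape (v h : EuclideanSpace ℂ (Fin L)) :
    ‖h‖ ^ 2 * orthogonalPower v (channelShape h) = orthogonalPower v h := by
  rcases eq_or_ne h 0 with rfl | h0
  · simp [orthogonalPower]
  · rw [channelShape, orthogonalPower_smul, Complex.norm_real, norm_inv, norm_norm, ← mul_assoc,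
      ← mul_pow, mul_inv_cancel₀ (norm_ne_zero_iff.2 h0), one_pow, one_mul]

end Beamforming

section Exponential
open Real Set

theorem abs_one_sub_exp_neg_sub_le {x : ℝ} (hx : 0 ≤ x) : |1 - exp (-x) - x| ≤ x ^ 2 / 2 := by
  have hupper : exp (-x) ≤ 1 - x + x ^ 2 / 2 := by
    rw [exp_neg]
    refine inv_le_of_inv_le₀ (by nlinarith [sq_nonneg (x - 1)]) ?_
    refine le_trans ?_ (quadratic_le_exp_of_nonneg hx)
    rw [inv_le_iff_one_le_mul₀ (by nlinarith [sq_nonneg (x - 1)])]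
    nlinarith [sq_nonneg (x ^ 2)]
  rw [abs_le]
  constructor <;> linarith [one_sub_le_exp_neg x, sq_nonneg x]

theorem measureReal_Icc_expMeasure {r b c : ℝ} (hr : 0 < r) (hb : 0 ≤ b) (hbc : b ≤ c) :
    (expMeasure r).real (Icc b c) = exp (-(r * b)) - exp (-(r * c)) := by
  have := isProbabilityMeasure_expMeasure hr
  have hIic {t : ℝ} (ht : 0 ≤ t) : (expMeasure r).real (Iic t) = 1 - exp (-(r * t)) := by
    rw [← cdf_eq_real, cdf_expMeasure_eq hr, if_pos ht]
  have hatom : NullSingletonClass (expMeasure r) := nullSingletonClass_withDensity _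
  have hIoc : Ioc b c = Iic c \ Iic b := by
    ext
    simp only [mem_Ioc, mem_sdiff, mem_Iic, not_le, and_comm]
  rw [measureReal_congr Ioc_ae_eq_Icc.symm, hIoc,
    measureReal_sdiff (Iic_subset_Iic.2 hbc) measurableSet_Iic, hIic hb, hIic (hb.trans hbc)]
  ring

theorem abs_measureReal_expMeasure_sub_le {a b y z : ℝ} (ha : 0 < a) (hb : 0 ≤ b) (hz : 0 ≤ z) :
    |(expMeasure 1).real {g | y ≤ a ∨ g ∈ Icc b (b * (1 + z / y))} -
      ((Iic a).indicator 1 y + exp (-b) * b * (Ioi a).indicator (·⁻¹) y * z)| ≤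
        b ^ 2 / (2 * a ^ 2) * z ^ 2 := by
  have := isProbabilityMeasure_expMeasure one_pos
  rcases le_or_gt y a with hy | hy
  · simp only [hy, true_or, Set.ofPred_true, probReal_univ, mem_Iic, indicator_of_mem, Pi.one_apply,
      mem_Ioi, not_lt.2 hy, not_false_eq_true, indicator_of_notMem, mul_zero, zero_mul, add_zero,
      sub_self, abs_zero]
    positivity
  · have hy0 : 0 < y := ha.trans hy
    set x := b * z / y
    have hx : 0 ≤ x := by positivity
    have hprob : (expMeasure 1).real {g | y ≤ a ∨ g ∈ Icc b (b * (1 + z / y))} =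
        exp (-b) * (1 - exp (-x)) := by
      have hset : {g | y ≤ a ∨ g ∈ Icc b (b * (1 + z / y))} = Icc b (b + x) := by
        simp only [not_le.2 hy, false_or, Set.ofPred_mem_eq, mul_add, mul_one, mul_div_assoc', x]
      rw [hset, measureReal_Icc_expMeasure one_pos hb (by linarith), one_mul, one_mul, neg_add,
        exp_add]
      ring
    rw [hprob]
    simp only [mem_Iic, not_le.2 hy, not_false_eq_true, indicator_of_notMem, mem_Ioi, hy,
      indicator_of_mem, zero_add]
    calc |exp (-b) * (1 - exp (-x)) - exp (-b) * b * y⁻¹ * z|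
        = exp (-b) * |1 - exp (-x) - x| := by
          rw [← abs_of_pos (exp_pos (-b)), ← abs_mul, abs_of_pos (exp_pos (-b))]
          congr 1
          simp only [x]
          ring
      _ ≤ 1 * (x ^ 2 / 2) := by
          gcongr
          · exact exp_le_one_iff.2 (by linarith)
          · exact abs_one_sub_exp_neg_sub_le hx
      _ = (b * z) ^ 2 / (2 * y ^ 2) := by
          simp only [x]
          ring
      _ ≤ (b * z) ^ 2 / (2 * a ^ 2) := by gcongr
      _ = b ^ 2 / (2 * a ^ 2) * z ^ 2 := by ring

theorem integrable_indicator_inv_Ioi {a : ℝ} (ha : 0 < a) (ρ : Measure ℝ) [IsFiniteMeasure ρ] :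
    Integrable ((Ioi a).indicator (·⁻¹)) ρ := by
  refine .of_bound (measurable_inv.indicator measurableSet_Ioi).aestronglyMeasurable a⁻¹
    (.of_forall fun y ↦ ?_)
  by_cases hy : a < y
  · rw [indicator_of_mem (mem_Ioi.2 hy), norm_inv, norm_of_nonneg (ha.trans hy).le]
    gcongr
  · rw [indicator_of_notMem (by simpa only [mem_Ioi] using hy), norm_zero]
    positivity

variable {Ω : Type*} [MeasurableSpace Ω] {μ : Measure Ω} {ρ : Measure ℝ}
  [IsProbabilityMeasure ρ] {G Y Z : Ω → ℝ} {a b : ℝ}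

theorem integrable_and_integral_indicator_add_mul_mul (ha : 0 < a) (c : ℝ) (hY : HasLaw Y ρ μ)
    (hYZ : IndepFun Y Z μ) (hZ : Integrable Z μ) :
    Integrable (fun ω ↦ (Iic a).indicator 1 (Y ω) + c * (Ioi a).indicator (·⁻¹) (Y ω) * Z ω) μ ∧
      ∫ ω, (Iic a).indicator 1 (Y ω) + c * (Ioi a).indicator (·⁻¹) (Y ω) * Z ω ∂μ =
        ρ.real (Iic a) + c * (∫ y in Ioi a, y⁻¹ ∂ρ) * ∫ ω, Z ω ∂μ := by
  have hone : Integrable ((Iic a).indicator (1 : ℝ → ℝ)) ρ :=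
    (integrable_const 1).indicator measurableSet_Iic
  have hone_int : Integrable (fun ω ↦ (Iic a).indicator (1 : ℝ → ℝ) (Y ω)) μ :=
    (hY.map_eq ▸ hone).comp_aemeasurable hY.aemeasurable
  have hinv := integrable_indicator_inv_Ioi ha ρ
  have hinv_int : Integrable (fun ω ↦ (Ioi a).indicator (·⁻¹) (Y ω)) μ :=
    (hY.map_eq ▸ hinv).comp_aemeasurable hY.aemeasurable
  have hindep : IndepFun (fun ω ↦ (Ioi a).indicator (·⁻¹) (Y ω)) Z μ :=
    hYZ.comp (measurable_inv.indicator measurableSet_Ioi) measurable_id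
  have hprod_int : Integrable (fun ω ↦ c * ((Ioi a).indicator (·⁻¹) (Y ω) * Z ω)) μ :=
    (hindep.integrable_mul hinv_int hZ).const_mul c
  simp only [mul_assoc]
  refine ⟨hone_int.add hprod_int, ?_⟩
  rw [integral_add hone_int hprod_int, integral_const_mul,
    hindep.integral_fun_mul_eq_mul_integral hinv_int.aestronglyMeasurable hZ.aestronglyMeasurable]
  congr 3
  · exact (hY.integral_comp hone.aestronglyMeasurable).trans
      (integral_indicator_one measurableSet_Iic)
  · exact (hY.integral_comp hinv.aestronglyMeasurable).trans (integral_indicator measurableSet_Ioi)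

theorem abs_measureReal_outage_sub_le [IsProbabilityMeasure μ] (ha : 0 < a) (hb : 0 ≤ b)
    (hG : HasLaw G (expMeasure 1) μ) (hY : HasLaw Y ρ μ)
    (hGYZ : IndepFun G (fun ω ↦ (Y ω, Z ω)) μ) (hYZ : IndepFun Y Z μ)
    (hZ0 : ∀ᵐ ω ∂μ, 0 ≤ Z ω) (hZ : MemLp Z 2 μ) :
    |μ.real {ω | Y ω ≤ a ∨ G ω ∈ Icc b (b * (1 + Z ω / Y ω))} -
      (ρ.real (Iic a) + exp (-b) * b * (∫ y in Ioi a, y⁻¹ ∂ρ) * ∫ ω, Z ω ∂μ)| ≤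
        b ^ 2 / (2 * a ^ 2) * ∫ ω, Z ω ^ 2 ∂μ := by
  have := isProbabilityMeasure_expMeasure one_pos
  have hYZm := hY.aemeasurable.prodMk hZ.aestronglyMeasurable.aemeasurable
  let S : Set (ℝ × ℝ × ℝ) := {x | x.2.1 ≤ a ∨ x.1 ∈ Icc b (b * (1 + x.2.2 / x.2.1))}
  have hS : MeasurableSet S := by
    have hupper : Measurable fun x : ℝ × ℝ × ℝ ↦ b * (1 + x.2.2 / x.2.1) := by fun_prop
    exact (measurableSet_le measurable_snd.fst measurable_const).union
      ((measurableSet_le measurable_const measurable_fst).inter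
        (measurableSet_le measurable_fst hupper))
  let prob (ω : Ω) : ℝ := (expMeasure 1).real {g | (g, Y ω, Z ω) ∈ S}
  let approx (ω : Ω) : ℝ :=
    (Iic a).indicator 1 (Y ω) + exp (-b) * b * (Ioi a).indicator (·⁻¹) (Y ω) * Z ω
  have hprob_int : Integrable prob μ := integrable_measureReal_section hYZm hS
  have hprob : μ.real {ω | Y ω ≤ a ∨ G ω ∈ Icc b (b * (1 + Z ω / Y ω))} = ∫ ω, prob ω ∂μ :=
    measureReal_eq_integral_section_of_indepFun hG hYZm hGYZ hS
  obtain ⟨happrox_int, happrox⟩ := integrable_and_integral_indicator_add_mul_mul ha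
    (exp (-b) * b) hY hYZ (hZ.integrable one_le_two)
  calc _ = |∫ ω, prob ω - approx ω ∂μ| := by
        rw [hprob, ← happrox, integral_sub hprob_int happrox_int]
    _ ≤ ∫ ω, |prob ω - approx ω| ∂μ := abs_integral_le_integral_abs
    _ ≤ ∫ ω, b ^ 2 / (2 * a ^ 2) * Z ω ^ 2 ∂μ := by
        refine integral_mono_ae (hprob_int.sub happrox_int).abs (hZ.integrable_sq.const_mul _) ?_
        filter_upwards [hZ0] with ω hω
        exact abs_measureReal_expMeasure_sub_le ha hb hω
    _ = b ^ 2 / (2 * a ^ 2) * ∫ ω, Z ω ^ 2 ∂μ := integral_const_mul _ _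

end Exponential

theorem rpow_neg_two_mul_div {b : ℝ} (hb : 0 ≤ b) (x y : ℝ) :
    b ^ (-(2 * x / y)) = (b ^ (-(x / y))) ^ 2 := by
  rw [← Real.rpow_mul_natCast hb, Nat.cast_ofNat, neg_mul, div_mul_eq_mul_div, mul_comm x]

theorem div_rpow_neg_div_pow {m : ℕ} (hm : m ≠ 0) {b : ℝ} (hb : 0 < b) (B t : ℝ) :
    (t / b ^ (-(B / m))) ^ m = b ^ B * t ^ m := by
  rw [div_pow, ← Real.rpow_mul_natCast hb.le, neg_mul, div_mul_cancel₀ _ (Nat.cast_ne_zero.2 hm),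
    Real.rpow_neg hb.le, div_inv_eq_mul, mul_comm]

section QuantizationMoments

variable {Ω : Type*} [MeasurableSpace Ω] {μ : Measure Ω} {X : Ω → ℝ} {δ : ℝ} {m : ℕ}

theorem ae_pos_of_measureReal_le_eq_div_pow [IsFiniteMeasure μ] (hδ : 0 ≤ δ) (hm : m ≠ 0)
    (hcdf : ∀ t, 0 ≤ t → t ≤ δ → μ.real {ω | X ω ≤ t} = (t / δ) ^ m) : ∀ᵐ ω ∂μ, 0 < X ω := by
  have hzero := hcdf 0 le_rfl hδ
  rw [zero_div, zero_pow hm, measureReal_eq_zero_iff] at hzero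
  simpa only [ae_iff, not_lt] using hzero

variable [IsProbabilityMeasure μ]

theorem measureReal_gt_eq_indicator_of_measureReal_le_eq_div_pow (hX : AEMeasurable X μ)
    (hδ : 0 < δ) (hcdf : ∀ t, 0 ≤ t → t ≤ δ → μ.real {ω | X ω ≤ t} = (t / δ) ^ m) {t : ℝ}
    (ht : 0 < t) :
    μ.real {ω | t < X ω} = (Set.Ioc 0 δ).indicator (fun t ↦ 1 - (t / δ) ^ m) t := by
  have hcompl : μ.real {ω | t < X ω} = 1 - μ.real {ω | X ω ≤ t} := by
    rw [← probReal_compl_eq_one_sub₀ (nullMeasurableSet_le hX aemeasurable_const)]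
    congr 1
    ext ω
    simp only [Set.mem_ofPred_eq, Set.mem_compl_iff, not_le]
  rw [hcompl]
  rcases le_or_gt t δ with htδ | htδ
  · rw [Set.indicator_of_mem (Set.mem_Ioc.2 ⟨ht, htδ⟩), hcdf t ht.le htδ]
  · rw [Set.indicator_of_notMem fun hmem ↦ htδ.not_ge hmem.2, sub_eq_zero]
    refine (measureReal_le_one.antisymm ?_).symm
    calc 1 = μ.real {ω | X ω ≤ δ} := by rw [hcdf δ hδ.le le_rfl, div_self hδ.ne', one_pow]
      _ ≤ μ.real {ω | X ω ≤ t} := measureReal_mono fun ω hω ↦ le_trans hω htδ.le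

theorem ae_le_of_measureReal_le_eq_div_pow (hX : AEMeasurable X μ) (hδ : 0 < δ)
    (hcdf : ∀ t, 0 ≤ t → t ≤ δ → μ.real {ω | X ω ≤ t} = (t / δ) ^ m) : ∀ᵐ ω ∂μ, X ω ≤ δ := by
  have hgt := measureReal_gt_eq_indicator_of_measureReal_le_eq_div_pow hX hδ hcdf hδ
  rw [Set.indicator_of_mem (Set.right_mem_Ioc.2 hδ), div_self hδ.ne', one_pow, sub_self,
    measureReal_eq_zero_iff] at hgt
  simpa only [ae_iff, not_le] using hgt

theorem integral_of_measureReal_le_eq_div_pow (hX : AEMeasurable X μ) (hδ : 0 < δ) (hm : m ≠ 0)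
    (hcdf : ∀ t, 0 ≤ t → t ≤ δ → μ.real {ω | X ω ≤ t} = (t / δ) ^ m) :
    ∫ ω, X ω ∂μ = m / (m + 1) * δ := by
  have hpos := ae_pos_of_measureReal_le_eq_div_pow hδ.le hm hcdf
  have hle := ae_le_of_measureReal_le_eq_div_pow hX hδ hcdf
  have hint : Integrable X μ := .of_mem_Icc 0 δ hX (by
    filter_upwards [hpos, hle] with ω h0 h1 using ⟨h0.le, h1⟩)
  calc ∫ ω, X ω ∂μ = ∫ t in Set.Ioi 0, μ.real {ω | t < X ω} :=
        hint.integral_eq_integral_meas_lt (hpos.mono fun _ h ↦ h.le)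
    _ = ∫ t in Set.Ioi 0, (Set.Ioc 0 δ).indicator (fun t ↦ 1 - (t / δ) ^ m) t :=
        setIntegral_congr_fun measurableSet_Ioi fun t ht ↦
          measureReal_gt_eq_indicator_of_measureReal_le_eq_div_pow hX hδ hcdf ht
    _ = ∫ t in 0..δ, 1 - (t / δ) ^ m := by
        rw [setIntegral_indicator measurableSet_Ioc,
          Set.inter_eq_self_of_subset_right Set.Ioc_subset_Ioi_self,
          ← intervalIntegral.integral_of_le hδ.le]
    _ = δ * ∫ t in 0..1, 1 - t ^ m := by
        rw [intervalIntegral.integral_comp_div (fun t ↦ 1 - t ^ m) hδ.ne', zero_div,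
          div_self hδ.ne', smul_eq_mul]
    _ = m / (m + 1) * δ := by
        rw [intervalIntegral.integral_sub (by simp) (by simp), intervalIntegral.integral_const,
          integral_pow]
        simp only [sub_zero, smul_eq_mul, mul_one, one_pow, zero_pow m.succ_ne_zero]
        field_simp
        ring

end QuantizationMoments

namespace CRParams

variable (p : CRParams) {g gx e y : ℝ}

theorem neZero_L : NeZero p.L := ⟨(two_pos.trans_le p.two_le_L).ne'⟩

theorem cast_L_pos : 0 < (p.L : ℝ) := Nat.cast_pos.2 (two_pos.trans_le p.two_le_L)

theorem L_sub_one_pos : 0 < (p.L : ℝ) - 1 :=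
  sub_pos.2 (Nat.one_lt_cast.2 (one_lt_two.trans_le p.two_le_L))

theorem gammaP_pos : 0 < p.gammaP := div_pos p.Pp_pos p.noise_pos

theorem gammaMax_pos : 0 < p.gammaMax := div_pos p.Pmax_pos p.noise_pos

theorem margin_nonneg_iff : 0 ≤ p.margin g ↔ p.thetaP / p.gammaP ≤ g := by
  rw [margin, mul_nonneg_iff_of_pos_left p.noise_pos, sub_nonneg, le_div_iff₀ p.thetaP_pos, one_mul,
    div_le_iff₀' p.gammaP_pos]

theorem powerLimit_eq_min (hg : 0 ≤ p.margin g) :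
    p.powerLimit g gx e = min (p.margin g / (p.lam * gx * e)) p.Pmax := by
  rw [powerLimit, ipc, if_pos hg, min_def_lt]
  simp only [hg, true_and]

theorem powerLimit_of_margin_neg (hg : ¬0 ≤ p.margin g) : p.powerLimit g gx e = p.Pmax :=
  if_neg fun h ↦ hg h.1

theorem powerLimit_nonneg (hgx : 0 ≤ gx) (he : 0 ≤ e) : 0 ≤ p.powerLimit g gx e := by
  have hlam := p.lam_pos
  by_cases hg : 0 ≤ p.margin g
  · rw [p.powerLimit_eq_min hg]
    exact le_min (by positivity) p.Pmax_pos.le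
  · rw [p.powerLimit_of_margin_neg hg]
    exact p.Pmax_pos.le

theorem margin_div_mul_le_iff (hy : 0 < y) (hgx : 0 < gx) (he : 0 < e) :
    p.margin g / (p.lam * gx * e) * y ≤ p.thetaS * p.noise ↔
      g ≤ p.thetaP / p.gammaP * (1 + p.thetaS * (p.lam * gx * e) / y) := by
  have hθp := p.thetaP_pos
  have hγp := p.gammaP_pos
  have hd : 0 < p.lam * gx * e := mul_pos (mul_pos p.lam_pos hgx) he
  have hfactor : p.thetaS * p.noise - p.margin g / (p.lam * gx * e) * y =
      p.noise * p.gammaP * y / (p.thetaP * (p.lam * gx * e)) *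
        (p.thetaP / p.gammaP * (1 + p.thetaS * (p.lam * gx * e) / y) - g) := by
    generalize p.lam * gx * e = d at hd ⊢
    rw [margin]
    field_simp
    ring
  rw [← sub_nonneg, hfactor, ← sub_nonneg (b := g), mul_nonneg_iff_of_pos_left]
  exact div_pos (mul_pos (mul_pos p.noise_pos hγp) hy) (mul_pos hθp hd)

theorem powerLimit_mul_le_iff (hy : 0 ≤ y) (hgx : 0 < gx) (he : 0 < e) :
    p.powerLimit g gx e * y ≤ p.thetaS * p.noise ↔
      y ≤ p.thetaS / p.gammaMax ∨ g ∈ Set.Icc (p.thetaP / p.gammaP)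
        (p.thetaP / p.gammaP * (1 + p.thetaS * (p.lam * gx * e) / y)) := by
  have hmax : p.Pmax * y ≤ p.thetaS * p.noise ↔ y ≤ p.thetaS / p.gammaMax := by
    rw [gammaMax, div_div_eq_mul_div, le_div_iff₀ p.Pmax_pos, mul_comm y]
  rw [Set.mem_Icc, ← margin_nonneg_iff]
  by_cases hg : 0 ≤ p.margin g
  · rw [p.powerLimit_eq_min hg, min_mul_of_nonneg _ _ hy, min_le_iff, hmax]
    rcases hy.eq_or_lt with rfl | hy
    · have : 0 ≤ p.thetaS / p.gammaMax := (div_pos p.thetaS_pos p.gammaMax_pos).le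
      simp only [this, or_true, true_or]
    · rw [p.margin_div_mul_le_iff hy hgx he, or_comm]
      simp only [hg, true_and]
  · rw [p.powerLimit_of_margin_neg hg, hmax]
    simp only [hg, false_and, or_false]

end CRParams

namespace OCBLink

section Gains

variable {p : CRParams} {Ω : Type u} [MeasurableSpace Ω] {μ : Measure Ω}
  {V : Type v} [MeasurableSpace V] (N : OCBLink p μ V)

/-- The direction `ŝ_x` that the primary receiver feeds back. -/
noncomputable def feedback (ω : Ω) : EuclideanSpace ℂ (Fin p.L) :=
  N.Q (channelShape (N.hx ω)) (N.U ω)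

/-- The normalized power `g_x` of the channel from the secondary transmitter to the primary
receiver. -/
noncomputable def crossGain (ω : Ω) : ℝ := ‖N.hx ω‖ ^ 2 / p.lam

/-- The power of the secondary channel left for beamforming orthogonally to the feedback. -/
noncomputable def orthogonalGain (ω : Ω) : ℝ := orthogonalPower (N.feedback ω) (N.hs ω)

/-- `θ_s` times the interference `λ g_x ε` that the beamformer causes per unit of power. -/
noncomputable def leakage (ω : Ω) : ℝ := p.thetaS * (p.lam * N.crossGain ω * N.quantError ω)

theorem quantError_le_one (ω : Ω) : N.quantError ω ≤ 1 := sub_le_self _ (by positivity)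

theorem aemeasurable_quantError : AEMeasurable N.quantError μ := by
  have hs : AEMeasurable (fun ω ↦ channelShape (N.hx ω)) μ :=
    measurable_channelShape.comp_aemeasurable N.law_hx.aemeasurable
  have hQ := N.measurable_Q.comp_aemeasurable (hs.prodMk N.measurable_U.aemeasurable)
  exact ((hQ.inner hs).norm.pow_const 2).const_sub 1

theorem hasLaw_primaryGain : HasLaw (fun ω ↦ ‖N.hp ω‖ ^ 2) (expMeasure 1) μ := by
  simpa only [div_one] using (hasLaw_normSq_div_complexGaussian one_pos).fun_comp N.law_hp

theorem hasLaw_crossGain : HasLaw N.crossGain (gammaMeasure p.L 1) μ :=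
  have := p.neZero_L
  (hasLaw_normSq_div_complexGaussianVector p.lam_pos).fun_comp N.law_hx

theorem ae_crossGain_pos : ∀ᵐ ω ∂μ, 0 < N.crossGain ω :=
  (N.hasLaw_crossGain.ae_iff measurableSet_Ioi.mem).2 (ae_pos_gammaMeasure _ _)

theorem ae_snrS_le_iff (hpos : ∀ᵐ ω ∂μ, 0 < N.quantError ω) :
    ∀ᵐ ω ∂μ, N.snrS ω ≤ p.thetaS ↔ N.orthogonalGain ω ≤ p.thetaS / p.gammaMax ∨
      ‖N.hp ω‖ ^ 2 ∈ Set.Icc (p.thetaP / p.gammaP)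
        (p.thetaP / p.gammaP * (1 + N.leakage ω / N.orthogonalGain ω)) := by
  filter_upwards [hpos, N.ae_crossGain_pos, N.norm_Q, N.isOCB] with ω he hgx hv hf
  have hy : 0 ≤ N.orthogonalGain ω := orthogonalPower_nonneg hv _
  have hpower : ‖N.hs ω‖ ^ 2 * ‖inner ℂ (N.f ω) (channelShape (N.hs ω))‖ ^ 2 =
      p.powerLimit (‖N.hp ω‖ ^ 2) (N.crossGain ω) (N.quantError ω) * N.orthogonalGain ω := by
    rw [hf.norm_inner_sq hv (p.powerLimit_nonneg hgx.le he.le), mul_left_comm,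
      normSq_mul_orthogonalPower_channelShape]
    rfl
  rw [leakage, ← p.powerLimit_mul_le_iff hy hgx he, snrS, div_mul_eq_mul_div,
    div_le_iff₀ p.noise_pos, hpower]

theorem outageProb_eq_measureReal (hpos : ∀ᵐ ω ∂μ, 0 < N.quantError ω) :
    N.outageProb = μ.real {ω | N.orthogonalGain ω ≤ p.thetaS / p.gammaMax ∨
      ‖N.hp ω‖ ^ 2 ∈ Set.Icc (p.thetaP / p.gammaP)
        (p.thetaP / p.gammaP * (1 + N.leakage ω / N.orthogonalGain ω))} :=
  measureReal_congr (Filter.eventuallyEq_set.2 (N.ae_snrS_le_iff hpos))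

theorem leakage_nonneg {ω : Ω} (he : 0 ≤ N.quantError ω) : 0 ≤ N.leakage ω := by
  have hθs := p.thetaS_pos
  have hlam := p.lam_pos
  rw [leakage, crossGain]
  positivity

theorem memLp_leakage (he : ∀ᵐ ω ∂μ, 0 ≤ N.quantError ω) : MemLp N.leakage 2 μ := by
  have hcross : MemLp N.crossGain 2 μ := by
    refine (memLp_two_iff_integrable_sq N.hasLaw_crossGain.aemeasurable.aestronglyMeasurable).2 ?_
    exact (N.hasLaw_crossGain.map_eq ▸ integrable_sq_gammaMeasure p.cast_L_pos).comp_aemeasurable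
      N.hasLaw_crossGain.aemeasurable
  have herror : MemLp N.quantError ⊤ μ :=
    memLp_top_of_bound N.aemeasurable_quantError.aestronglyMeasurable 1 <| he.mono fun ω h ↦ by
      rw [Real.norm_of_nonneg h]
      exact N.quantError_le_one ω
  have hprod : MemLp (fun ω ↦ p.lam * N.crossGain ω * N.quantError ω) 2 μ :=
    herror.mul (hcross.const_mul p.lam)
  exact hprod.const_mul p.thetaS

theorem exists_measurable_leakage_eq :
    ∃ F : EuclideanSpace ℂ (Fin p.L) × V → ℝ, Measurable F ∧
      N.leakage = fun ω ↦ F (N.hx ω, N.U ω) := by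
  have hshape : Measurable fun x : EuclideanSpace ℂ (Fin p.L) × V ↦ channelShape x.1 :=
    measurable_channelShape.comp measurable_fst
  have hquant : Measurable fun x : EuclideanSpace ℂ (Fin p.L) × V ↦ N.Q (channelShape x.1) x.2 :=
    N.measurable_Q.comp (hshape.prodMk measurable_snd)
  have herror : Measurable fun x : EuclideanSpace ℂ (Fin p.L) × V ↦
      1 - ‖inner ℂ (N.Q (channelShape x.1) x.2) (channelShape x.1)‖ ^ 2 :=
    ((hquant.inner hshape).norm.pow_const 2).const_sub 1
  have hgain : Measurable fun x : EuclideanSpace ℂ (Fin p.L) × V ↦ ‖x.1‖ ^ 2 / p.lam :=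
    (measurable_fst.norm.pow_const 2).div_const p.lam
  exact ⟨_, ((hgain.const_mul p.lam).mul herror).const_mul p.thetaS, rfl⟩

theorem indepFun_primaryGain_orthogonalGain_leakage :
    IndepFun (fun ω ↦ ‖N.hp ω‖ ^ 2) (fun ω ↦ (N.orthogonalGain ω, N.leakage ω)) μ := by
  obtain ⟨F, hF, hF_eq⟩ := N.exists_measurable_leakage_eq
  have hquant : Measurable fun x : EuclideanSpace ℂ (Fin p.L) × EuclideanSpace ℂ (Fin p.L) × V ↦
      N.Q (channelShape x.2.1) x.2.2 :=
    N.measurable_Q.comp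
      ((measurable_channelShape.comp measurable_snd.fst).prodMk measurable_snd.snd)
  have hgains : Measurable fun x : EuclideanSpace ℂ (Fin p.L) × EuclideanSpace ℂ (Fin p.L) × V ↦
      (orthogonalPower (N.Q (channelShape x.2.1) x.2.2) x.1, F x.2) :=
    (measurable_orthogonalPower hquant measurable_fst).prodMk (hF.comp measurable_snd)
  rw [hF_eq]
  exact N.indep_hp.comp (measurable_norm.pow_const 2) hgains

theorem IsBBitFeedback.measureReal_quantError_le {N : OCBLink p μ V} {B : ℕ}
    (hN : N.IsBBitFeedback B) (τ : ℝ) (h0 : 0 ≤ τ) (hτ : τ ≤ 2 ^ (-((B : ℝ) / (p.L - 1)))) :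
    μ.real {ω | N.quantError ω ≤ τ} = (τ / 2 ^ (-((B : ℝ) / (p.L - 1)))) ^ (p.L - 1) := by
  have hL : p.L - 1 ≠ 0 := (Nat.sub_pos_of_lt p.two_le_L).ne'
  rw [hN τ h0 hτ, ← Nat.cast_pred (two_pos.trans_le p.two_le_L), div_rpow_neg_div_pow hL two_pos,
    Real.rpow_natCast]

variable [IsProbabilityMeasure μ]

theorem indepFun_crossGain_quantError : IndepFun N.crossGain N.quantError μ := by
  have := p.neZero_L
  have hhx := N.law_hx.aemeasurable
  have hshape : AEMeasurable (fun ω ↦ channelShape (N.hx ω)) μ :=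
    measurable_channelShape.comp_aemeasurable hhx
  have hnorm_shape : IndepFun (fun ω ↦ ‖N.hx ω‖) (fun ω ↦ channelShape (N.hx ω)) μ := by
    refine (indepFun_comp_iff_of_hasLaw N.law_hx measurable_norm measurable_channelShape).2 ?_
    rw [funext channelShape_eq_normalize]
    exact indepFun_norm_normalize_complexGaussianVector p.lam_pos
  have hnorm_shape_U : IndepFun (fun ω ↦ ‖N.hx ω‖) (fun ω ↦ (channelShape (N.hx ω), N.U ω)) μ :=
    indepFun_prodMk_right hhx.norm hshape N.measurable_U.aemeasurable hnorm_shape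
      (N.indep_hx.comp (measurable_norm.prodMk measurable_channelShape) measurable_id)
  have herror : Measurable fun x : EuclideanSpace ℂ (Fin p.L) × V ↦
      1 - ‖inner ℂ (N.Q x.1 x.2) x.1‖ ^ 2 :=
    ((N.measurable_Q.inner measurable_fst).norm.pow_const 2).const_sub 1
  exact hnorm_shape_U.comp ((measurable_id.pow_const 2).div_const p.lam) herror

theorem hasLaw_orthogonalGain_and_indepFun :
    HasLaw N.orthogonalGain (gammaMeasure (p.L - 1) 1) μ ∧
      IndepFun N.orthogonalGain (fun ω ↦ (N.hx ω, N.U ω)) μ := by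
  have := isProbabilityMeasure_gammaMeasure (a := p.L - 1) (r := 1) p.L_sub_one_pos one_pos
  let q (x : EuclideanSpace ℂ (Fin p.L) × V) := N.Q (channelShape x.1) x.2
  have hq : Measurable q :=
    N.measurable_Q.comp ((measurable_channelShape.comp measurable_fst).prodMk measurable_snd)
  have hhxU : AEMeasurable (fun ω ↦ (N.hx ω, N.U ω)) μ :=
    N.law_hx.aemeasurable.prodMk N.measurable_U.aemeasurable
  have hunit : ∀ᵐ x ∂μ.map (fun ω ↦ (N.hx ω, N.U ω)), ‖q x‖ = 1 :=
    (ae_map_iff hhxU (measurableSet_eq_fun hq.norm measurable_const)).2 N.norm_Q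
  have hg : Measurable (Function.uncurry fun x h ↦ orthogonalPower (q x) h) :=
    measurable_orthogonalPower (hq.comp measurable_fst) measurable_snd
  refine hasLaw_and_indepFun_of_ae_hasLaw N.law_hs hhxU
    N.indep_hs hg (hunit.mono fun x hx ↦ ?_)
  simpa only [div_one] using
    hasLaw_orthogonalPower_div_complexGaussianVector p.two_le_L one_pos hx

theorem integral_leakage :
    ∫ ω, N.leakage ω ∂μ = p.thetaS * p.lam * p.L * ∫ ω, N.quantError ω ∂μ := by
  calc ∫ ω, N.leakage ω ∂μ
      = p.thetaS * p.lam * ∫ ω, N.crossGain ω * N.quantError ω ∂μ := by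
        rw [← integral_const_mul]
        simp only [leakage, mul_assoc]
    _ = p.thetaS * p.lam * p.L * ∫ ω, N.quantError ω ∂μ := by
        rw [N.indepFun_crossGain_quantError.integral_fun_mul_eq_mul_integral
          N.hasLaw_crossGain.aemeasurable.aestronglyMeasurable
          N.aemeasurable_quantError.aestronglyMeasurable, N.hasLaw_crossGain.integral_eq,
          integral_id_gammaMeasure p.cast_L_pos, mul_assoc _ (p.L : ℝ)]

theorem integral_leakage_sq :
    ∫ ω, N.leakage ω ^ 2 ∂μ =
      (p.thetaS * p.lam) ^ 2 * (p.L * (p.L + 1)) * ∫ ω, N.quantError ω ^ 2 ∂μ := by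
  have hsq : Measurable fun x : ℝ ↦ x ^ 2 := measurable_id.pow_const 2
  have hindep : IndepFun (fun ω ↦ N.crossGain ω ^ 2) (fun ω ↦ N.quantError ω ^ 2) μ :=
    N.indepFun_crossGain_quantError.comp hsq hsq
  have hcross : ∫ ω, N.crossGain ω ^ 2 ∂μ = p.L * (p.L + 1) :=
    (N.hasLaw_crossGain.integral_comp hsq.aestronglyMeasurable).trans
      (integral_sq_gammaMeasure p.cast_L_pos)
  calc ∫ ω, N.leakage ω ^ 2 ∂μ
      = (p.thetaS * p.lam) ^ 2 * ∫ ω, N.crossGain ω ^ 2 * N.quantError ω ^ 2 ∂μ := by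
        rw [← integral_const_mul]
        simp only [leakage, mul_pow, mul_assoc]
    _ = (p.thetaS * p.lam) ^ 2 * (p.L * (p.L + 1)) * ∫ ω, N.quantError ω ^ 2 ∂μ := by
        rw [hindep.integral_fun_mul_eq_mul_integral
          (N.hasLaw_crossGain.aemeasurable.pow_const 2).aestronglyMeasurable
          (N.aemeasurable_quantError.pow_const 2).aestronglyMeasurable, hcross, mul_assoc _ (_ * _)]

theorem indepFun_orthogonalGain_leakage : IndepFun N.orthogonalGain N.leakage μ := by
  obtain ⟨F, hF, hF_eq⟩ := N.exists_measurable_leakage_eq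
  rw [hF_eq]
  exact N.hasLaw_orthogonalGain_and_indepFun.2.comp measurable_id hF

theorem abs_outageProb_sub_le (hpos : ∀ᵐ ω ∂μ, 0 < N.quantError ω) :
    |N.outageProb -
      (1 - upperGamma (p.L - 1) (p.thetaS / p.gammaMax) / Real.Gamma (p.L - 1) +
        Real.exp (-(p.thetaP / p.gammaP)) * (p.thetaP / p.gammaP) *
          (upperGamma (p.L - 2) (p.thetaS / p.gammaMax) / Real.Gamma (p.L - 1)) *
          (p.thetaS * p.lam * p.L * ∫ ω, N.quantError ω ∂μ))| ≤
      (p.thetaP / p.gammaP) ^ 2 / (2 * (p.thetaS / p.gammaMax) ^ 2) *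
        ((p.thetaS * p.lam) ^ 2 * (p.L * (p.L + 1)) * ∫ ω, N.quantError ω ^ 2 ∂μ) := by
  have := isProbabilityMeasure_gammaMeasure (a := p.L - 1) (r := 1) p.L_sub_one_pos one_pos
  have ha : 0 < p.thetaS / p.gammaMax := div_pos p.thetaS_pos p.gammaMax_pos
  have hb : 0 < p.thetaP / p.gammaP := div_pos p.thetaP_pos p.gammaP_pos
  have hnonneg : ∀ᵐ ω ∂μ, 0 ≤ N.quantError ω := hpos.mono fun _ h ↦ h.le
  have houtage := abs_measureReal_outage_sub_le ha hb.le N.hasLaw_primaryGain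
    N.hasLaw_orthogonalGain_and_indepFun.1 N.indepFun_primaryGain_orthogonalGain_leakage
    N.indepFun_orthogonalGain_leakage (hnonneg.mono fun _ ↦ N.leakage_nonneg)
    (N.memLp_leakage hnonneg)
  rwa [measureReal_Iic_gammaMeasure p.L_sub_one_pos ha.le,
    setIntegral_Ioi_inv_gammaMeasure p.L_sub_one_pos ha.le, integral_leakage, integral_leakage_sq,
    sub_sub (p.L : ℝ), one_add_one_eq_two, ← N.outageProb_eq_measureReal hpos] at houtage

end Gains

end OCBLink

theorem mainTheorem1_general (p : CRParams) {Ω : Type u} [MeasurableSpace Ω] {μ : Measure Ω}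
    [IsProbabilityMeasure μ] {V : Type v} [MeasurableSpace V] (N : OCBLink p μ V) {δ : ℝ}
    (hδ : 0 < δ) (hcdf : ∀ τ, 0 ≤ τ → τ ≤ δ →
      μ.real {ω | N.quantError ω ≤ τ} = (τ / δ) ^ (p.L - 1)) :
    |N.outageProb -
      (1 - upperGamma (p.L - 1) (p.thetaS / p.gammaMax) / Real.Gamma (p.L - 1) + p.phi * δ)| ≤
      (p.lam * p.thetaP * p.gammaMax / p.gammaP) ^ 2 * (p.L * (p.L + 1) / 2) * δ ^ 2 := by
  have hL : p.L - 1 ≠ 0 := (Nat.sub_pos_of_lt p.two_le_L).ne'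
  have herror := N.aemeasurable_quantError
  have hpos := ae_pos_of_measureReal_le_eq_div_pow hδ.le hL hcdf
  have hle := ae_le_of_measureReal_le_eq_div_pow herror hδ hcdf
  have hmean : p.L * ∫ ω, N.quantError ω ∂μ = (p.L - 1) * δ := by
    rw [integral_of_measureReal_le_eq_div_pow herror hδ hL hcdf,
      Nat.cast_pred (two_pos.trans_le p.two_le_L), sub_add_cancel]
    have := p.cast_L_pos.ne'
    field_simp
  have hsq : ∫ ω, N.quantError ω ^ 2 ∂μ ≤ δ ^ 2 := by
    calc ∫ ω, N.quantError ω ^ 2 ∂μ ≤ ∫ _, δ ^ 2 ∂μ := by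
          refine integral_mono_of_nonneg (.of_forall fun _ ↦ sq_nonneg _) (integrable_const _) ?_
          filter_upwards [hpos, hle] with ω h0 h1 using pow_le_pow_left₀ h0.le h1 2
      _ = δ ^ 2 := by rw [integral_const, probReal_univ, one_smul]
  calc _ = _ := by
        rw [mul_assoc _ (p.L : ℝ), hmean, CRParams.phi]
        congr 3
        ring
    _ ≤ _ := N.abs_outageProb_sub_le hpos
    _ ≤ (p.thetaP / p.gammaP) ^ 2 / (2 * (p.thetaS / p.gammaMax) ^ 2) *
        ((p.thetaS * p.lam) ^ 2 * (p.L * (p.L + 1)) * δ ^ 2) := by gcongr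
    _ = _ := by
        have := p.thetaS_pos.ne'
        have := p.gammaMax_pos.ne'
        field_simp

theorem mainTheorem1 (p : CRParams) :
    ∃ C : ℝ, ∀ (B : ℕ) (Ω : Type u) [MeasurableSpace Ω] (μ : Measure Ω) [IsProbabilityMeasure μ]
      (V : Type v) [MeasurableSpace V] (N : OCBLink p μ V), N.IsBBitFeedback B →
      |N.outageProb -
        (1 - upperGamma ((p.L : ℝ) - 1) (p.thetaS / p.gammaMax) / Real.Gamma ((p.L : ℝ) - 1)
          + p.phi * (2 : ℝ) ^ (-((B : ℝ) / ((p.L : ℝ) - 1))))|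
        ≤ C * (2 : ℝ) ^ (-(2 * (B : ℝ) / ((p.L : ℝ) - 1))) :=
  ⟨_, fun _ _ _ _ _ _ _ N hN ↦
    (mainTheorem1_general p N (Real.rpow_pos_of_pos two_pos _)
      hN.measureReal_quantError_le).trans_eq
      (congrArg _ (rpow_neg_two_mul_div two_pos.le _ _).symm)⟩
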